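/- Let $c$ and $m$ be integers with $m>1$, and let $d$ be a positive rational number such that $dm\in\mathbb{N}$, $c+dm>0$, and not both $c=0$ and $dm=1$. Put $$a=\frac{c-\sqrt{c^2+4}}{2},\qquad b=\frac{c+\sqrt{c^2+4}}{2},$$ and write $(z;q)_n=\prod_{k=0}^{n-1}(1-zq^k)$, with $(z;q)_0=1$. Then the infinite continued fraction with partial quotients $c+dm^n$ $(n\ge 1)$ converges, and $$[0;\,c+dm,\;c+dm^2,\;c+dm^3,\dots]=\frac{1}{md+a}\cdot\frac{\displaystyle\sum_{n=0}^{\infty}\frac{(b/d)^n\,m^{-n(n+3)/2}}{(1/m;1/m)_n\,\bigl(-a/(dm^2);1/m\bigr)_n}}{\displaystyle\sum_{n=0}^{\infty}\frac{(b/d)^n\,m^{-n(n+1)/2}}{(1/m;1/m)_n\,\bigl(-a/(dm);1/m\bigr)_n}},$$ where $md+a\neq 0$, none of the finite products in the denominators vanishes, both series converge, and the sum of the series in the denominator is nonzero. -/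

import Mathlib

open Filter Topology

/-- The continued fraction `[b₀; b 0, b 1, b 2, …]` with infinitely many partial quotients `b n`
(all partial numerators are `1`). -/
def infiniteCF (b₀ : ℝ) (b : ℕ → ℝ) : SimpContFract ℝ :=
  ⟨⟨b₀, Stream'.Seq.ofStream fun n => ⟨1, b n⟩⟩, by
    intro n a h
    simp only [GenContFract.partNums, Stream'.Seq.map_get?] at h
    change some (1 : ℝ) = some a at h
    exact (Option.some.inj h).symm⟩

/-- `x = [b₀; b 0, b 1, b 2, …]`: the convergents of the continued fraction tend to `x`. -/
def CFHasValue (b₀ : ℝ) (b : ℕ → ℝ) (x : ℝ) : Prop :=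
  Tendsto (fun n => (infiniteCF b₀ b : GenContFract ℝ).convs n) atTop (𝓝 x)

/-- The finite `q`-product `(z; q)_n = ∏_{k = 0}^{n - 1} (1 - z q ^ k)`. -/
noncomputable def qPochhammer (z q : ℝ) (n : ℕ) : ℝ :=
  ∏ k ∈ Finset.range n, (1 - z * q ^ k)

/-- `(b / d) ^ n m ^ (-n (n + 3) / 2) / ((1/m; 1/m)_n (-a / (d m²); 1/m)_n)`.
The division by `2` of natural numbers is exact, as `n (n + 3)` is even. -/
noncomputable def numTerm (a b d m : ℝ) (n : ℕ) : ℝ :=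
  (b / d) ^ n * m ^ (-((n * (n + 3) / 2 : ℕ) : ℤ)) /
    (qPochhammer (1 / m) (1 / m) n * qPochhammer (-a / (d * m ^ 2)) (1 / m) n)

/-- `(b / d) ^ n m ^ (-n (n + 1) / 2) / ((1/m; 1/m)_n (-a / (d m); 1/m)_n)`.
The division by `2` of natural numbers is exact, as `n (n + 1)` is even. -/
noncomputable def denTerm (a b d m : ℝ) (n : ℕ) : ℝ :=
  (b / d) ^ n * m ^ (-((n * (n + 1) / 2 : ℕ) : ℤ)) /
    (qPochhammer (1 / m) (1 / m) n * qPochhammer (-a / (d * m)) (1 / m) n)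

/-! With `q = 1/m`, both series are values `F 0`, `F 1` of one family of `q`-hypergeometric sums, `F
s` having parameters `b/(d m^(s+1))` and `-a/(d m^(s+1))`. The contiguous relation
`tsum_phiTerm_contiguous`, together with `a + b = c` and `a b = -1`, becomes after division by
products of `d m^j + a` the recurrence `G n = (c + d m^(n+1)) G (n+1) + G (n+2)`. A positive
solution of it tends to `0`, so the convergents tend to `G 1 / G 0` (`cfHasValue_of_recurrence`).
Positivity rests on `d m + a > 0`, proved in `mul_add_root_pos`. -/

theorem choose_succ_two (n : ℕ) : (n + 1).choose 2 = n + n.choose 2 := by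
  rw [Nat.choose_succ_succ' n 1, Nat.choose_one_right]

theorem qPochhammer_succ (z q : ℝ) (n : ℕ) :
    qPochhammer z q (n + 1) = qPochhammer z q n * (1 - z * q ^ n) := by
  simp [qPochhammer, Finset.prod_range_succ]

/-- Both sides are `(z; q)_{n+1}`, with the first or the last factor split off. -/
theorem one_sub_mul_qPochhammer (z q : ℝ) (n : ℕ) :
    (1 - z) * qPochhammer (q * z) q n = qPochhammer z q n * (1 - z * q ^ n) := by
  rw [← qPochhammer_succ, qPochhammer, qPochhammer, Finset.prod_range_succ']
  simp only [pow_zero, mul_one]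
  rw [mul_comm]
  congr 1
  exact Finset.prod_congr rfl fun k _ => by ring

theorem one_sub_mul_pow_pos {z q : ℝ} (hq0 : 0 ≤ q) (hq1 : q ≤ 1) (hz0 : 0 ≤ z) (hz1 : z < 1)
    (k : ℕ) : 0 < 1 - z * q ^ k := by
  nlinarith [pow_le_one₀ (n := k) hq0 hq1, pow_nonneg hq0 k]

theorem qPochhammer_pos {z q : ℝ} (hq0 : 0 ≤ q) (hq1 : q ≤ 1) (hz0 : 0 ≤ z) (hz1 : z < 1)
    (n : ℕ) : 0 < qPochhammer z q n :=
  Finset.prod_pos fun k _ => one_sub_mul_pow_pos hq0 hq1 hz0 hz1 k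

/-- The term `x ^ n q ^ (n (n - 1) / 2) / ((q; q)_n (z; q)_n)` of a basic hypergeometric series. -/
noncomputable def phiTerm (q x z : ℝ) (n : ℕ) : ℝ :=
  x ^ n * q ^ n.choose 2 / (qPochhammer q q n * qPochhammer z q n)

/-! ### Basic hypergeometric series and their contiguous relation -/

section phi

variable {q x z : ℝ}

theorem phiTerm_pos (hq0 : 0 < q) (hq1 : q < 1) (hx : 0 < x) (hz0 : 0 ≤ z) (hz1 : z < 1)
    (n : ℕ) : 0 < phiTerm q x z n :=
  div_pos (by positivity) (mul_pos (qPochhammer_pos hq0.le hq1.le hq0.le hq1 n)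
    (qPochhammer_pos hq0.le hq1.le hz0 hz1 n))

theorem phiTerm_succ (q x z : ℝ) (n : ℕ) :
    phiTerm q x z (n + 1) =
      phiTerm q x z n * (x * q ^ n / ((1 - q * q ^ n) * (1 - z * q ^ n))) := by
  rw [phiTerm, phiTerm, qPochhammer_succ, qPochhammer_succ, choose_succ_two,
    div_mul_div_comm]
  congr 1 <;> ring

theorem phiTerm_mul_left (q x z t : ℝ) (n : ℕ) :
    phiTerm q (t * x) z n = t ^ n * phiTerm q x z n := by
  rw [phiTerm, phiTerm]
  ring

theorem one_sub_mul_phiTerm (hq0 : 0 < q) (hq1 : q < 1) (hz0 : 0 ≤ z) (hz1 : z < 1) (n : ℕ) :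
    (1 - z) * phiTerm q x z n = phiTerm q x (q * z) n * (1 - z * q ^ n) := by
  have hqz0 : 0 ≤ q * z := by positivity
  have hqz1 : q * z < 1 := by nlinarith
  have h := one_sub_mul_qPochhammer z q n
  have h1 := (qPochhammer_pos hq0.le hq1.le hq0.le hq1 n).ne'
  have h2 := (qPochhammer_pos hq0.le hq1.le hz0 hz1 n).ne'
  have h3 := (qPochhammer_pos hq0.le hq1.le hqz0 hqz1 n).ne'
  rw [phiTerm, phiTerm, mul_div_assoc', div_mul_eq_mul_div,
    div_eq_div_iff (mul_ne_zero h1 h2) (mul_ne_zero h1 h3)]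
  linear_combination x ^ n * q ^ n.choose 2 * qPochhammer q q n * h

theorem summable_phiTerm (hq0 : 0 < q) (hq1 : q < 1) (hx : 0 < x) (hz0 : 0 ≤ z) (hz1 : z < 1) :
    Summable (phiTerm q x z) := by
  have hpos := phiTerm_pos hq0 hq1 hx hz0 hz1
  refine summable_of_ratio_test_tendsto_lt_one (l := 0) one_pos
    (Eventually.of_forall fun n => (hpos n).ne') ?_
  have hq : Tendsto (fun n : ℕ => q ^ n) atTop (𝓝 0) :=
    tendsto_pow_atTop_nhds_zero_of_lt_one hq0.le hq1
  have h : Tendsto (fun n : ℕ => x * q ^ n / ((1 - q * q ^ n) * (1 - z * q ^ n))) atTop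
      (𝓝 (x * 0 / ((1 - q * 0) * (1 - z * 0)))) :=
    (hq.const_mul x).div (((hq.const_mul q).const_sub 1).mul ((hq.const_mul z).const_sub 1))
      (by simp)
  rw [mul_zero, zero_div] at h
  refine h.congr fun n => ?_
  rw [Real.norm_of_nonneg (hpos _).le, Real.norm_of_nonneg (hpos _).le, phiTerm_succ,
    mul_div_cancel_left₀ _ (hpos n).ne']

/-- The three-term contiguous relation. -/
theorem tsum_phiTerm_contiguous (hq0 : 0 < q) (hq1 : q < 1) (hx : 0 < x) (hz0 : 0 ≤ z)
    (hz1 : z < 1) :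
    (1 - z) * ∑' n, phiTerm q x z n =
      (1 + x - z) * ∑' n, phiTerm q (q * x) (q * z) n +
        q * x * z / (1 - q * z) * ∑' n, phiTerm q (q * (q * x)) (q * (q * z)) n := by
  have hqz0 : 0 ≤ q * z := by positivity
  have hqz1 : q * z < 1 := by nlinarith
  have hqqz0 : 0 ≤ q * (q * z) := by positivity
  have hqqz1 : q * (q * z) < 1 := by nlinarith
  have hqx : 0 < q * x := by positivity
  have hqqx : 0 < q * (q * x) := by positivity
  have s0 := summable_phiTerm hq0 hq1 hx hz0 hz1
  have s1 := summable_phiTerm hq0 hq1 hqx hqz0 hqz1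
  have s2 := summable_phiTerm hq0 hq1 hqqx hqqz0 hqqz1
  have su := summable_phiTerm hq0 hq1 hx hqz0 hqz1
  -- The relation holds termwise only up to the telescoping difference `w n - w (n + 1)`. The factor
  -- `1 - q ^ n` gives `w 0 = 0`, so the differences sum to zero.
  set w : ℕ → ℝ := fun n => phiTerm q x (q * z) n * (1 - q ^ n) with hw
  have sw : Summable w := by
    refine (su.sub s1).congr fun n => ?_
    rw [phiTerm_mul_left, hw]
    ring
  have hshift : ∑' n, w (n + 1) = ∑' n, w n := by
    rw [sw.tsum_eq_zero_add]
    simp [hw]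
  have key : ∀ n, (1 - z) * phiTerm q x z n =
      (1 + x - z) * phiTerm q (q * x) (q * z) n +
        q * x * z / (1 - q * z) * phiTerm q (q * (q * x)) (q * (q * z)) n +
        (w n - w (n + 1)) := by
    intro n
    have e2 := one_sub_mul_phiTerm (x := x) hq0 hq1 hqz0 hqz1 n
    have p1 : 1 - q * z ≠ 0 := by linarith
    have p2 : 1 - q * z * q ^ n ≠ 0 := (one_sub_mul_pow_pos hq0.le hq1.le hqz0 hqz1 n).ne'
    have p3 : 1 - q * q ^ n ≠ 0 := (one_sub_mul_pow_pos hq0.le hq1.le hq0.le hq1 n).ne'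
    have e2' : phiTerm q x (q * (q * z)) n =
        (1 - q * z) * phiTerm q x (q * z) n / (1 - q * z * q ^ n) := by
      rw [eq_div_iff p2, e2]
    simp only [hw]
    -- Every term becomes a rational multiple of `phiTerm q x (q * z) n`, leaving an identity in `q
    -- ^ n`.
    rw [one_sub_mul_phiTerm hq0 hq1 hz0 hz1, phiTerm_mul_left q x, phiTerm_mul_left q (q * x),
      phiTerm_mul_left q x, e2', phiTerm_succ, pow_succ]
    have p3' : 1 - q ^ n * q ≠ 0 := by rwa [mul_comm]
    field_simp
    ring
  have sw' : Summable fun n => w (n + 1) := (summable_nat_add_iff 1).2 sw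
  rw [← tsum_mul_left, ← tsum_mul_left, ← tsum_mul_left, tsum_congr key,
    ((s1.mul_left _).add (s2.mul_left _)).tsum_add (sw.sub sw'),
    (s1.mul_left _).tsum_add (s2.mul_left _), sw.tsum_sub sw', hshift, sub_self, add_zero]

end phi

/-! ### Convergence from a positive solution of the recurrence -/

section continuedFraction

variable (b : ℕ → ℝ)

theorem infiniteCF_s_get? (b₀ : ℝ) (n : ℕ) :
    (infiniteCF b₀ b : GenContFract ℝ).s.get? n = some ⟨1, b n⟩ := rfl

theorem infiniteCF_nums_zero (b₀ : ℝ) : (infiniteCF b₀ b : GenContFract ℝ).nums 0 = b₀ := by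
  rw [GenContFract.zeroth_num_eq_h]
  rfl

theorem infiniteCF_nums_one (b₀ : ℝ) :
    (infiniteCF b₀ b : GenContFract ℝ).nums 1 = b 0 * b₀ + 1 :=
  GenContFract.first_num_eq (infiniteCF_s_get? b b₀ 0)

theorem infiniteCF_dens_one (b₀ : ℝ) : (infiniteCF b₀ b : GenContFract ℝ).dens 1 = b 0 :=
  GenContFract.first_den_eq (infiniteCF_s_get? b b₀ 0)

theorem infiniteCF_nums_add_two (b₀ : ℝ) (n : ℕ) :
    (infiniteCF b₀ b : GenContFract ℝ).nums (n + 2) =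
      b (n + 1) * (infiniteCF b₀ b : GenContFract ℝ).nums (n + 1) +
        (infiniteCF b₀ b : GenContFract ℝ).nums n := by
  rw [GenContFract.nums_recurrence (infiniteCF_s_get? b b₀ (n + 1)) rfl rfl, one_mul]

theorem infiniteCF_dens_add_two (b₀ : ℝ) (n : ℕ) :
    (infiniteCF b₀ b : GenContFract ℝ).dens (n + 2) =
      b (n + 1) * (infiniteCF b₀ b : GenContFract ℝ).dens (n + 1) +
        (infiniteCF b₀ b : GenContFract ℝ).dens n := by
  rw [GenContFract.dens_recurrence (infiniteCF_s_get? b b₀ (n + 1)) rfl rfl, one_mul]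

variable {b}

theorem one_le_infiniteCF_dens (hb : ∀ n, 1 ≤ b n) (b₀ : ℝ) (n : ℕ) :
    1 ≤ (infiniteCF b₀ b : GenContFract ℝ).dens n := by
  induction n using Nat.twoStepInduction with
  | zero => rw [GenContFract.zeroth_den_eq_one]
  | one => rw [infiniteCF_dens_one]; exact hb 0
  | more n h0 h1 =>
    rw [infiniteCF_dens_add_two]
    nlinarith [hb (n + 1)]

/-- The alternating sign turns the backward recurrence of `G` into the forward one of the numerators
and denominators. -/
theorem infiniteCF_linear_form {G : ℕ → ℝ} (hG : ∀ n, G n = b n * G (n + 1) + G (n + 2)) (n : ℕ) :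
    (infiniteCF 0 b : GenContFract ℝ).nums n * G 0 -
      (infiniteCF 0 b : GenContFract ℝ).dens n * G 1 = (-1) ^ (n + 1) * G (n + 1) := by
  induction n using Nat.twoStepInduction with
  | zero =>
    rw [infiniteCF_nums_zero, GenContFract.zeroth_den_eq_one]
    ring
  | one =>
    rw [infiniteCF_nums_one, infiniteCF_dens_one]
    linear_combination hG 0
  | more n h0 h1 =>
    rw [infiniteCF_nums_add_two, infiniteCF_dens_add_two]
    linear_combination b (n + 1) * h1 + h0 - (-1) ^ n * hG (n + 1)

theorem tendsto_zero_of_recurrence {G : ℕ → ℝ} (hb : ∀ n, 1 ≤ b n) (hpos : ∀ n, 0 < G n)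
    (hG : ∀ n, G n = b n * G (n + 1) + G (n + 2)) : Tendsto G atTop (𝓝 0) := by
  have hle : ∀ n, G (n + 1) + G (n + 2) ≤ G n := fun n => by
    nlinarith [hb n, hpos (n + 1), hG n]
  have hanti : Antitone G := antitone_nat_of_succ_le fun n => by
    linarith [hle n, hpos (n + 2)]
  have hlim := tendsto_atTop_ciInf hanti ⟨0, by rintro _ ⟨n, rfl⟩; exact (hpos n).le⟩
  have h1 := (tendsto_add_atTop_iff_nat 1).2 hlim
  have h2 := (tendsto_add_atTop_iff_nat 2).2 hlim
  -- The limit `L` satisfies `L + L ≤ L`, hence `L ≤ 0`.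
  have hL := le_of_tendsto_of_tendsto' (h1.add h2) hlim hle
  have hL0 : 0 ≤ ⨅ n, G n := ge_of_tendsto' hlim fun n => (hpos n).le
  rwa [show ⨅ n, G n = 0 by linarith] at hlim

/-- A positive solution of the three-term recurrence gives the value of the continued fraction. -/
theorem cfHasValue_of_recurrence {G : ℕ → ℝ} (hb : ∀ n, 1 ≤ b n) (hpos : ∀ n, 0 < G n)
    (hG : ∀ n, G n = b n * G (n + 1) + G (n + 2)) : CFHasValue 0 b (G 1 / G 0) := by
  rw [CFHasValue, tendsto_iff_norm_sub_tendsto_zero]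
  have h0 : Tendsto (fun n => G (n + 1) / G 0) atTop (𝓝 0) := by
    simpa using ((tendsto_add_atTop_iff_nat 1).2
      (tendsto_zero_of_recurrence hb hpos hG)).div_const (G 0)
  refine squeeze_zero (fun _ => norm_nonneg _) (fun n => ?_) h0
  have hd := one_le_infiniteCF_dens hb 0 n
  have hd0 : 0 < (infiniteCF 0 b : GenContFract ℝ).dens n := by linarith
  rw [GenContFract.conv_eq_num_div_den, div_sub_div _ _ hd0.ne' (hpos 0).ne',
    infiniteCF_linear_form hG, norm_div, norm_mul, norm_pow, norm_neg, norm_one, one_pow, one_mul,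
    Real.norm_of_nonneg (hpos _).le, Real.norm_of_nonneg (mul_pos hd0 (hpos 0)).le]
  exact div_le_div_of_nonneg_left (hpos _).le (hpos 0) (by nlinarith [hpos 0])

end continuedFraction

/-! ### Specialization to the stated series -/

theorem mul_succ_div_two (n : ℕ) : n * (n + 1) / 2 = n + n.choose 2 := by
  rw [← choose_succ_two, Nat.choose_two_right, Nat.add_sub_cancel, mul_comm]

/-- Since `n(n+1)/2 = n + n.choose 2`, the extra `m ^ (-n)` is absorbed into the argument. -/
theorem denTerm_eq_phiTerm (a b d m : ℝ) :
    denTerm a b d m = phiTerm (1 / m) (b / (d * m)) (-a / (d * m)) := by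
  funext n
  rw [denTerm, phiTerm, mul_succ_div_two, zpow_neg, zpow_natCast, pow_add, ← div_div b d m, div_pow (b / d) m,
    one_div_pow]
  congr 1
  rw [mul_inv]
  ring

theorem numTerm_eq_phiTerm (a b d m : ℝ) :
    numTerm a b d m = phiTerm (1 / m) (b / (d * m ^ 2)) (-a / (d * m ^ 2)) := by
  funext n
  have h : n * (n + 3) / 2 = 2 * n + n.choose 2 := by
    rw [show n * (n + 3) = n * (n + 1) + n * 2 by ring, Nat.add_mul_div_right _ _ two_pos,
      mul_succ_div_two]
    ring
  rw [numTerm, phiTerm, h, zpow_neg, zpow_natCast, pow_add, ← div_div b d, div_pow (b / d) (m ^ 2),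
    one_div_pow, pow_mul]
  congr 1
  rw [mul_inv]
  ring

/-- The value of the continued fraction with partial quotients `a + b + d m ^ n`, where `a b = -1`
and `a` is negative but larger than `-d m`. -/
theorem cfHasValue_phiTerm {a b d m : ℝ} (hm : 1 < m) (hd : 0 < d) (ha : a < 0) (hb : 0 < b)
    (hab : a * b = -1) (hda : 0 < m * d + a) (hq : 1 ≤ a + b + d * m) :
    CFHasValue 0 (fun n : ℕ => a + b + d * m ^ (n + 1))
      (1 / (m * d + a) * ((∑' n, phiTerm (1 / m) (b / (d * m ^ 2)) (-a / (d * m ^ 2)) n) /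
        ∑' n, phiTerm (1 / m) (b / (d * m)) (-a / (d * m)) n)) := by
  have hm0 : 0 < m := by linarith
  have hq0 : 0 < 1 / m := by positivity
  have hq1 : 1 / m < 1 := by rwa [div_lt_one hm0]
  have hmpow : ∀ s : ℕ, d * m ≤ d * m ^ (s + 1) := fun s =>
    mul_le_mul_of_nonneg_left (le_self_pow₀ hm.le s.succ_ne_zero) hd.le
  have hfac : ∀ s : ℕ, 0 < d * m ^ (s + 1) + a := fun s => by linarith [hmpow s]
  have hz0 : ∀ s : ℕ, 0 ≤ -a / (d * m ^ (s + 1)) := fun s =>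
    div_nonneg (by linarith) (by positivity)
  have hz1 : ∀ s : ℕ, -a / (d * m ^ (s + 1)) < 1 := fun s => by
    rw [div_lt_one (by positivity)]
    linarith [hfac s]
  have hx : ∀ s : ℕ, 0 < b / (d * m ^ (s + 1)) := fun s => by positivity
  set F : ℕ → ℝ := fun s =>
    ∑' n, phiTerm (1 / m) (b / (d * m ^ (s + 1))) (-a / (d * m ^ (s + 1))) n with hF
  have hFpos : ∀ s, 0 < F s := fun s =>
    (summable_phiTerm hq0 hq1 (hx s) (hz0 s) (hz1 s)).tsum_pos
      (fun n => (phiTerm_pos hq0 hq1 (hx s) (hz0 s) (hz1 s) n).le) 0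
      (phiTerm_pos hq0 hq1 (hx s) (hz0 s) (hz1 s) 0)
  have hrec : ∀ s, (d * m ^ (s + 1) + a) * F s =
      (a + b + d * m ^ (s + 1)) * F (s + 1) + F (s + 2) / (d * m ^ (s + 2) + a) := by
    intro s
    have h := tsum_phiTerm_contiguous hq0 hq1 (hx s) (hz0 s) (hz1 s)
    have hshift : ∀ (t : ℝ) (k : ℕ), 1 / m * (t / (d * m ^ k)) = t / (d * m ^ (k + 1)) := by
      intro t k
      rw [div_mul_div_comm, one_mul]
      ring
    simp only [hshift] at h
    -- Here `a b = -1` makes the numerator `1`.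
    have hcoef : b / (d * m ^ (s + 1 + 1)) * (-a / (d * m ^ (s + 1))) /
        (1 - -a / (d * m ^ (s + 1 + 1))) = 1 / (d * m ^ (s + 1)) * (1 / (d * m ^ (s + 2) + a)) := by
      have h1 : d * m ^ (s + 2) + a ≠ 0 := (hfac (s + 1)).ne'
      have hX : d * m ^ (s + 1) ≠ 0 := by positivity
      have hY : d * m ^ (s + 2) ≠ 0 := by positivity
      rw [show s + 1 + 1 = s + 2 from rfl]
      generalize d * m ^ (s + 1) = X at *
      generalize d * m ^ (s + 2) = Y at *
      have h2 : 1 - -a / Y = (Y + a) / Y := by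
        field_simp
        ring
      rw [h2]
      field_simp
      linear_combination -hab
    rw [hcoef] at h
    change _ * F s = _ * F (s + 1) + _ * F (s + 2) at h
    have hp : d * m ^ (s + 1) ≠ 0 := by positivity
    have e1 : d * m ^ (s + 1) * (1 - -a / (d * m ^ (s + 1))) = d * m ^ (s + 1) + a := by
      field_simp
      ring
    have e2 : d * m ^ (s + 1) * (1 + b / (d * m ^ (s + 1)) - -a / (d * m ^ (s + 1))) =
        a + b + d * m ^ (s + 1) := by
      field_simp
      ring
    have e3 : d * m ^ (s + 1) * (1 / (d * m ^ (s + 1)) * (1 / (d * m ^ (s + 2) + a))) =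
        1 / (d * m ^ (s + 2) + a) := by
      rw [← mul_assoc, mul_one_div_cancel hp, one_mul]
    rw [← e1, ← e2, div_eq_mul_one_div (F (s + 2)), ← e3]
    linear_combination (d * m ^ (s + 1)) * h
  -- Dividing `F s` by `P s` normalizes the last coefficient of `hrec` to `1`.
  set P : ℕ → ℝ := fun s => ∏ j ∈ Finset.range s, (d * m ^ (j + 1) + a) with hP
  have hPpos : ∀ s, 0 < P s := fun s => Finset.prod_pos fun j _ => hfac j
  have hPsucc : ∀ s, P (s + 1) = P s * (d * m ^ (s + 1) + a) := fun s =>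
    Finset.prod_range_succ _ s
  have hval := cfHasValue_of_recurrence (b := fun n : ℕ => a + b + d * m ^ (n + 1))
    (G := fun s => F s / P s) (fun n => by linarith [hmpow n])
    (fun s => div_pos (hFpos s) (hPpos s)) (fun s => by
      have h1 := (hfac s).ne'
      have h2 := (hfac (s + 1)).ne'
      have h3 := (hPpos s).ne'
      have h := hrec s
      rw [hPsucc (s + 1), hPsucc s]
      rw [show s + 1 + 1 = s + 2 from rfl] at *
      field_simp at h ⊢
      linear_combination h)
  convert hval using 1
  have hP0 : P 0 = 1 := by simp [hP]
  have hP1 : P 1 = m * d + a := by simp [hP, mul_comm]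
  have hF0 : F 0 = ∑' n, phiTerm (1 / m) (b / (d * m)) (-a / (d * m)) n := by simp [hF]
  rw [hP0, hP1, hF0, div_one, div_right_comm, div_eq_mul_one_div (_ / _), mul_comm]

/-- `(N + a)(N + b) = N k - 1`, which is positive because `N` and `k` are positive integers, not
both `1`. -/
theorem mul_add_root_pos {c k : ℤ} {N : ℕ} {a b : ℝ} (hk : (k : ℝ) = c + N) (hk0 : 0 < k)
    (hN : 0 < N) (hne : ¬ (c = 0 ∧ N = 1)) (hsum : a + b = c) (hab : a * b = -1) (hb : 0 < b) :
    0 < N + a := by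
  have hk' : k = c + N := by exact_mod_cast hk
  have hprod : 1 < (N : ℤ) * k := by
    by_contra! h
    have h1 : (N : ℤ) = 1 := by nlinarith
    have h2 : k = 1 := by nlinarith
    exact hne ⟨by omega, by omega⟩
  have hprod' : (1 : ℝ) < N * k := by exact_mod_cast hprod
  have hfac : ((N : ℝ) + a) * (N + b) = N * k - 1 := by
    rw [hk]
    linear_combination (N : ℝ) * hsum + hab
  have hNb : 0 < (N : ℝ) + b := by positivity
  by_contra! h
  nlinarith [mul_nonneg (neg_nonneg.2 h) hNb.le]

theorem mainTheorem8 (c m : ℤ) (d : ℚ) (hm : 1 < m) (hd : 0 < d)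
    (hdm : ∃ k : ℕ, d * (m : ℚ) = (k : ℚ)) (hcdm : 0 < (c : ℚ) + d * (m : ℚ))
    (hne : ¬ (c = 0 ∧ d * (m : ℚ) = 1))
    (a b : ℝ) (ha : a = ((c : ℝ) - √((c : ℝ) ^ 2 + 4)) / 2)
    (hb : b = ((c : ℝ) + √((c : ℝ) ^ 2 + 4)) / 2) :
    -- no denominator below vanishes
    (m : ℝ) * (d : ℝ) + a ≠ 0 ∧
    (∀ n : ℕ, qPochhammer (1 / (m : ℝ)) (1 / (m : ℝ)) n ≠ 0 ∧
      qPochhammer (-a / ((d : ℝ) * (m : ℝ) ^ 2)) (1 / (m : ℝ)) n ≠ 0 ∧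
      qPochhammer (-a / ((d : ℝ) * (m : ℝ))) (1 / (m : ℝ)) n ≠ 0) ∧
    -- both series converge, and the second one has a nonzero sum
    Summable (numTerm a b (d : ℝ) (m : ℝ)) ∧
    Summable (denTerm a b (d : ℝ) (m : ℝ)) ∧
    (∑' n : ℕ, denTerm a b (d : ℝ) (m : ℝ) n) ≠ 0 ∧
    -- the continued fraction converges to the stated value
    CFHasValue 0 (fun n : ℕ => (c : ℝ) + (d : ℝ) * (m : ℝ) ^ (n + 1))
      (1 / ((m : ℝ) * (d : ℝ) + a) *
        ((∑' n : ℕ, numTerm a b (d : ℝ) (m : ℝ) n) /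
          (∑' n : ℕ, denTerm a b (d : ℝ) (m : ℝ) n))) := by

  have hm1 : (1 : ℝ) < m := by exact_mod_cast hm
  have hm0 : (0 : ℝ) < m := by linarith
  have hdR : (0 : ℝ) < d := by exact_mod_cast hd
  have hq0 : (0 : ℝ) < 1 / m := by positivity
  have hq1 : 1 / (m : ℝ) < 1 := by rwa [div_lt_one hm0]
  have hsq : √((c : ℝ) ^ 2 + 4) ^ 2 = (c : ℝ) ^ 2 + 4 := Real.sq_sqrt (by positivity)
  have habs : |(c : ℝ)| < √((c : ℝ) ^ 2 + 4) := by
    rw [← Real.sqrt_sq_eq_abs]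
    exact Real.sqrt_lt_sqrt (by positivity) (by linarith)
  have ha0 : a < 0 := by linarith [le_abs_self (c : ℝ)]
  have hb0 : 0 < b := by linarith [neg_abs_le (c : ℝ)]
  have hsum : a + b = c := by rw [ha, hb]; ring
  have hab : a * b = -1 := by rw [ha, hb]; linear_combination -hsq / 4
  obtain ⟨N, hN⟩ := hdm
  have hNR : (d : ℝ) * m = N := by exact_mod_cast hN
  have hN0 : 0 < N := by
    have : (0 : ℝ) < N := by rw [← hNR]; positivity
    exact_mod_cast this
  have hk0 : 0 < c + (N : ℤ) := by
    rw [hN] at hcdm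
    exact_mod_cast hcdm
  have hda : 0 < (m : ℝ) * d + a := by
    rw [mul_comm, hNR]
    refine mul_add_root_pos (k := c + N) (by push_cast; rfl) hk0 hN0 ?_ hsum hab hb0
    rintro ⟨h1, h2⟩
    exact hne ⟨h1, by rw [hN, h2]; simp⟩
  -- Integrality upgrades `0 < c + d m` to `1 ≤ c + d m`.
  have hk1 : 1 ≤ a + b + (d : ℝ) * m := by
    rw [hsum, hNR]
    exact_mod_cast hk0
  have hx1 : 0 < b / ((d : ℝ) * m) := by positivity
  have hx2 : 0 < b / ((d : ℝ) * m ^ 2) := by positivity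
  have hz1 : 0 ≤ -a / ((d : ℝ) * m) := div_nonneg (by linarith) (by positivity)
  have hz2 : 0 ≤ -a / ((d : ℝ) * m ^ 2) := div_nonneg (by linarith) (by positivity)
  have hz1' : -a / ((d : ℝ) * m) < 1 := by
    rw [div_lt_one (by positivity)]
    linarith
  have hz2' : -a / ((d : ℝ) * m ^ 2) < 1 := by
    rw [div_lt_one (by positivity)]
    nlinarith [mul_pos hdR hm0]
  have hs1 := summable_phiTerm hq0 hq1 hx1 hz1 hz1'
  have hp1 := phiTerm_pos hq0 hq1 hx1 hz1 hz1'
  rw [numTerm_eq_phiTerm a b d, denTerm_eq_phiTerm a b d, ← hsum]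
  exact ⟨hda.ne', fun n => ⟨(qPochhammer_pos hq0.le hq1.le hq0.le hq1 n).ne',
      (qPochhammer_pos hq0.le hq1.le hz2 hz2' n).ne',
      (qPochhammer_pos hq0.le hq1.le hz1 hz1' n).ne'⟩,
    summable_phiTerm hq0 hq1 hx2 hz2 hz2', hs1,
    (hs1.tsum_pos (fun n => (hp1 n).le) 0 (hp1 0)).ne',
    cfHasValue_phiTerm hm1 hdR ha0 hb0 hab hda hk1⟩
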